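/- **Setting.** Let $0<s<1$ and let $(\phi,\psi)$, $\psi=\{\psi_\epsilon\}_{\epsilon\in\alpha}$ with $\alpha$ finite, be a compactly supported, continuously differentiable orthonormal wavelet system of $L^2(\mathbb R^n)$ whose wavelet functions $\psi_\epsilon$ are real-valued. That is: there is an increasing sequence $(V_j)_{j\in\mathbb Z}$ of closed subspaces of $L^2(\mathbb R^n)$ with $\bigcap_j V_j=\{0\}$ and $\overline{\bigcup_j V_j}=L^2(\mathbb R^n)$, with $f\in V_j\iff f(2\,\cdot)\in V_{j+1}$ and $f\in V_0\iff f(\cdot-\mathbf k)\in V_0$ for $\mathbf k\in\mathbb Z^n$; $\int\phi=1$ and, for every $j$, $\{2^{nj/2}\phi(2^j\cdot-\mathbf k)\}_{\mathbf k\in\mathbb Z^n}$ is an orthonormal basis of $V_j$; $\int\psi_\epsilon=0$ and, for every $j$, the functions $\psi_{(\epsilon,(j,\mathbf k))}(\mathbf x)=2^{nj/2}\psi_\epsilon(2^j\mathbf x-\mathbf k)$, $\epsilon\in\alpha$, $\mathbf k\in\mathbb Z^n$, form an orthonormal basis of the orthogonal complement of $V_j$ in $V_{j+1}$. For a compact set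 $K\subseteq\mathbb R^n$ let $\mathcal P_{\mathrm{ab2}}(K)$ be the set of probability measures on $K$ with square-integrable Lebesgue density. For $\mu,\nu\in\mathcal P_{\mathrm{ab2}}(K)$ with densities $p_\mu,p_\nu$ and $j_0\in\mathbb Z$ put $$W_s(\mu,\nu)=\inf_{\gamma}\int|\mathbf x-\mathbf y|^s\,d\gamma(\mathbf x,\mathbf y),$$ the infimum being over all couplings $\gamma$ of $\mu$ and $\nu$, and $$(W_{\mathrm{wav}}^{(\psi,j_0)})_s(\mu,\nu)=\sum_{\epsilon\in\alpha,\;j\ge j_0,\;\mathbf k\in\mathbb Z^n}2^{-j(s+\frac n2)}\left|\int_{\mathbb R^n}(p_\mu-p_\nu)\,\overline{\psi_{(\epsilon,(j,\mathbf k))}}\,d\mathbf x\right| .$$ Finally let $$E_{\psi,s}=a_{14}(\psi,s)=\frac1{\max_{\epsilon\in\alpha}\|\psi_\epsilon\|_{(\dot C^s(\mathbb R^n))^*}},\qquad \|g\|_{(\dot C^s(\mathbb R^n))^*}=\sup_f\left|\int_{\mathbb R^n} f g\,d\mathbf x\right| ,$$ where $f$ runs over all functions $f:\mathbb R^n\to\mathbb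 C$ with $f(\mathbf 0)=0$ and $|f(\mathbf x)-f(\mathbf y)|\le|\mathbf x-\mathbf y|^s$ for all $\mathbf x,\mathbf y$. **Claim.** Let $K\subseteq\mathbb R^n$ be compact with nonempty interior. Then $0<E_{\psi,s}<\infty$, and: 1. For every $j_0\in\mathbb Z$ there are $\epsilon'\in\alpha$, $j'\ge j_0$ and $\mathbf k'\in\mathbb Z^n$ such that $g=\psi_{(\epsilon',(j',\mathbf k'))}$ is supported in $K$, $\int g^+=\int g^-=C$ for some $C>0$, the measures $d\mu=(g^+/C)\,d\mathbf x$ and $d\nu=(g^- /C)\,d\mathbf x$ belong to $\mathcal P_{\mathrm{ab2}}(K)$, $0<W_s(\mu,\nu)<\infty$, and $$E_{\psi,s}\,W_s(\mu,\nu)=(W_{\mathrm{wav}}^{(\psi,j)})_s(\mu,\nu)\qquad\text{for all integers } j\le j',$$ in particular for $j=j_0$. 2. Consequently the constant $E_{\psi,s}$ in the lower bound $E_{\psi,s}W_s-\eta\le(W_{\mathrm{wav}}^{(\psi,j_0)})_s$ cannot be improved: if $c\ge0$ is such that for every $\eta>0$ there is $j_0\in\mathbb Z$ with $c\,W_s(\mu,\nu)-\eta\le(W_{\mathrm{wav}}^{(\psi,j_0)})_s(\mu,\nu)$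 for all $\mu,\nu\in\mathcal P_{\mathrm{ab2}}(K)$, then $c\le E_{\psi,s}$. -/

import Mathlib

open MeasureTheory Set
open scoped ENNReal NNReal ComplexConjugate

noncomputable section

/-- Euclidean space `ℝⁿ`, with the Euclidean norm and Lebesgue measure `volume`. -/
abbrev Rn (n : ℕ) : Type := EuclideanSpace ℝ (Fin n)

/-- The complex Hilbert space `L²(ℝⁿ)`. -/
abbrev L2 (n : ℕ) : Type := Lp ℂ 2 (volume : Measure (Rn n))

/-- The lattice vector `k ∈ ℤⁿ`, seen in `ℝⁿ`. -/
def latticeVec {n : ℕ} (k : Fin n → ℤ) : Rn n := WithLp.toLp 2 (fun i => (k i : ℝ))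

/-- `f_{(j,k)}(x) = 2^{nj/2} f(2^j x - k)`. -/
def dilate {n : ℕ} (f : Rn n → ℂ) (j : ℤ) (k : Fin n → ℤ) (x : Rn n) : ℂ :=
  (((2 : ℝ) ^ ((n : ℝ) * (j : ℝ) / 2) : ℝ) : ℂ) * f ((2 : ℝ) ^ j • x - latticeVec k)

/-- The functions `u i` are square-integrable and their classes in `L²(ℝⁿ)` form an orthonormal
Hilbert basis of the closed subspace `V`. -/
def IsHilbertBasisOf {n : ℕ} {ι : Type*} (u : ι → Rn n → ℂ) (V : Submodule ℂ (L2 n)) : Prop :=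
  ∃ h : ∀ i, MemLp (u i) 2 (volume : Measure (Rn n)),
    Orthonormal ℂ (fun i => (h i).toLp (u i)) ∧
    (Submodule.span ℂ (range fun i => (h i).toLp (u i))).topologicalClosure = V

/-- `V` is a multiresolution approximation of `L²(ℝⁿ)` with scaling function `φ`. -/
structure IsMultiresolution {n : ℕ} (V : ℤ → Submodule ℂ (L2 n)) (φ : Rn n → ℂ) : Prop where
  isClosed : ∀ j, IsClosed (V j : Set (L2 n))
  mono : Monotone V
  inter : (⋂ j, (V j : Set (L2 n))) = {0}
  dense : Dense (⋃ j, (V j : Set (L2 n)))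
  dilation : ∀ (j : ℤ) (f g : L2 n),
    (∀ᵐ x ∂(volume : Measure (Rn n)), g x = f ((2 : ℝ) • x)) → (f ∈ V j ↔ g ∈ V (j + 1))
  translation : ∀ (k : Fin n → ℤ) (f g : L2 n),
    (∀ᵐ x ∂(volume : Measure (Rn n)), g x = f (x - latticeVec k)) → (f ∈ V 0 ↔ g ∈ V 0)
  scaling_integrable : Integrable φ
  scaling_integral : ∫ x, φ x = 1
  scaling_basis : ∀ j : ℤ, IsHilbertBasisOf (fun k : Fin n → ℤ => dilate φ j k) (V j)

/-- `(φ, ψ)` is an orthonormal wavelet system: `φ` is the scaling function of a multiresolution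
approximation `V`, every `ψ ε` integrates to `0`, and for each `j` the functions `ψ_{(ε,(j,k))}`
form a Hilbert basis of the orthogonal complement `W_j` of `V_j` in `V_{j+1}`. -/
def IsWaveletSystem {n : ℕ} {α : Type*} (φ : Rn n → ℂ) (ψ : α → Rn n → ℂ) : Prop :=
  ∃ V : ℤ → Submodule ℂ (L2 n), IsMultiresolution V φ ∧
    (∀ ε, Integrable (ψ ε) ∧ ∫ x, ψ ε x = 0) ∧
    ∀ j : ℤ, IsHilbertBasisOf (fun i : α × (Fin n → ℤ) => dilate (ψ i.1) j i.2)
      ((V j)ᗮ ⊓ V (j + 1))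

/-- The measures in `𝒫_ab2(K)`: probability measures on `ℝⁿ` that are concentrated on `K` and
absolutely continuous with square-integrable density. -/
structure IsAb2On {n : ℕ} (K : Set (Rn n)) (μ : Measure (Rn n)) : Prop where
  isProbability : IsProbabilityMeasure μ
  concentrated : μ Kᶜ = 0
  absolutelyContinuous : μ ≪ volume
  sq_integrable : MemLp (fun x => (μ.rnDeriv volume x).toReal) 2 (volume : Measure (Rn n))

/-- The `s`-Wasserstein distance: the infimum of `∫ |x - y|^s dγ` over the transport plans `γ`. -/
def wassersteinDist {n : ℕ} (s : ℝ≥0) (μ ν : Measure (Rn n)) : ℝ≥0∞ :=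
  ⨅ (γ : Measure (Rn n × Rn n)) (_ : γ.map Prod.fst = μ) (_ : γ.map Prod.snd = ν),
    ∫⁻ p, edist p.1 p.2 ^ (s : ℝ) ∂γ

/-- The detail coefficient of `f` with respect to `ψ_{(ε,(j,k))}`. -/
def detailCoeff {n : ℕ} {α : Type*} (ψ : α → Rn n → ℂ) (f : Rn n → ℂ)
    (ε : α) (j : ℤ) (k : Fin n → ℤ) : ℂ :=
  ∫ x, f x * conj (dilate (ψ ε) j k x)

/-- The difference `p_μ - p_ν` of the Lebesgue densities of `μ` and `ν`. -/
def densityDiff {n : ℕ} (μ ν : Measure (Rn n)) (x : Rn n) : ℂ :=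
  (((μ.rnDeriv volume x).toReal - (ν.rnDeriv volume x).toReal : ℝ) : ℂ)

/-- The wavelet `s`-Wasserstein distance with lowest level `j₀`: the sum over all `ε`, `j ≥ j₀`,
`k` of `2^{-j(s+n/2)} |(p_μ - p_ν)_{(ε,(j,k))}|`. -/
def waveletDist {n : ℕ} {α : Type*} (ψ : α → Rn n → ℂ) (j₀ : ℤ) (s : ℝ≥0)
    (μ ν : Measure (Rn n)) : ℝ≥0∞ :=
  ∑' i : α × {j : ℤ // j₀ ≤ j} × (Fin n → ℤ),
    ENNReal.ofReal ((2 : ℝ) ^ (-((i.2.1.1 : ℤ) : ℝ) * ((s : ℝ) + (n : ℝ) / 2))) *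
      ‖detailCoeff ψ (densityDiff μ ν) i.1 i.2.1.1 i.2.2‖ₑ

/-- The operator norm of `f ↦ ∫ f g` on the homogeneous `s`-Hölder space of `ℝⁿ`, realized by
the functions `f : ℝⁿ → ℂ` with `f 0 = 0` and normed by the Hölder seminorm. -/
def holderDualNorm {n : ℕ} (s : ℝ≥0) (g : Rn n → ℂ) : ℝ≥0∞ :=
  ⨆ (f : Rn n → ℂ) (_ : HolderWith 1 s f) (_ : f 0 = 0), ‖∫ x, f x * g x‖ₑ

/-- The constant `E_{ψ,s} = a₁₄(ψ,s) = 1 / max_ε ‖ψ_ε‖`, with the norms `holderDualNorm s`. -/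
def lowerConst {n : ℕ} {α : Type*} (ψ : α → Rn n → ℂ) (s : ℝ≥0) : ℝ≥0∞ :=
  (⨆ ε, holderDualNorm s (ψ ε))⁻¹

/-- The measure `(g⁺ / C) dx`, where `g⁺` is the positive part of the real part of `g`. -/
def posMeasure {n : ℕ} (g : Rn n → ℂ) (C : ℝ) : Measure (Rn n) :=
  volume.withDensity fun x => ENNReal.ofReal ((g x).re⁺ / C)

/-- The measure `(g⁻ / C) dx`, where `g⁻ ≥ 0` is the negative part of the real part of `g`. -/
def negMeasure {n : ℕ} (g : Rn n → ℂ) (C : ℝ) : Measure (Rn n) :=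
  volume.withDensity fun x => ENNReal.ofReal ((g x).re⁻ / C)

end

/-! The two parts of a mean-zero wavelet `g`, divided by their common mass `C`, give measures whose
densities differ by `g / C`. Both distances can then be computed exactly. Orthonormality across
positions, indices and levels leaves a single term in the wavelet distance, `2^(-j'(s+n/2)) / C`.
Since `|x - y|^s` is a metric for `0 < s ≤ 1`, Kantorovich-Rubinstein duality turns the Wasserstein
distance into the dual Hölder norm of `g` divided by `C`. An affine change of variables shows that
this norm is `2^(-j'(s+n/2))` times the norm of the mother wavelet. The scale and `C` cancel in the
quotient, leaving the reciprocal of that norm; for a wavelet of maximal norm this is `lowerConst`.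
At fine scales a translate of its support fits into `K`. Optimality follows by inserting this one
pair into the assumed inequality: lowering the level only enlarges the wavelet distance, the pair is
independent of `η`, and its Wasserstein distance is positive and finite, so `η` tends to `0` and the
distance cancels. The duality is proved by Hahn-Banach: a functional on `C(X × Y)` dominated by the
dual infimum is positive and has the right marginals, so Riesz-Markov represents it by a coupling.
-/

/-! ### Kantorovich duality on compact metric spaces -/

section Kantorovich

variable {X Y : Type*} [MetricSpace X] [CompactSpace X] [MeasurableSpace X] [BorelSpace X]
  [MetricSpace Y] [CompactSpace Y] [MeasurableSpace Y] [BorelSpace Y]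

/-- The values `∫ u dμ + ∫ v dν` of the continuous pairs `(u, v)` with `h(x, y) ≤ u x + v y`. -/
def upperDualValues (μ : Measure X) (ν : Measure Y) (h : C(X × Y, ℝ)) : Set ℝ :=
  {t | ∃ (u : C(X, ℝ)) (v : C(Y, ℝ)), (∀ x y, h (x, y) ≤ u x + v y) ∧
    t = ∫ x, u x ∂μ + ∫ y, v y ∂ν}

theorem ContinuousMap.integrable_of_compactSpace {Z : Type*} [MetricSpace Z] [CompactSpace Z]
    [MeasurableSpace Z] [BorelSpace Z] (μ : Measure Z) [IsFiniteMeasure μ] (u : C(Z, ℝ)) :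
    Integrable u μ :=
  u.continuous.integrable_of_hasCompactSupport (HasCompactSupport.of_compactSpace _)

theorem upperDualValues_const_mem (μ : Measure X) (ν : Measure Y) [IsProbabilityMeasure μ]
    [IsProbabilityMeasure ν] (h : C(X × Y, ℝ)) (M : ℝ) (hM : ∀ p, h p ≤ M) :
    M ∈ upperDualValues μ ν h :=
  ⟨.const X M, .const Y 0, fun x y => by simpa using hM (x, y), by simp⟩

/-- Integrate `m ≤ u x + v y` first in `x`, then in `y`. -/
theorem le_of_mem_upperDualValues {μ : Measure X} {ν : Measure Y} [IsProbabilityMeasure μ]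
    [IsProbabilityMeasure ν] {h : C(X × Y, ℝ)} {m t : ℝ} (hm : ∀ p, m ≤ h p)
    (ht : t ∈ upperDualValues μ ν h) : m ≤ t := by
  obtain ⟨u, v, huv, rfl⟩ := ht
  have hu := u.integrable_of_compactSpace μ
  have hv := v.integrable_of_compactSpace ν
  have h1 : ∀ y, m - v y ≤ ∫ x, u x ∂μ := fun y => by
    have : ∫ _ : X, (m - v y) ∂μ ≤ ∫ x, u x ∂μ :=
      integral_mono (integrable_const _) hu fun x => by
        have := huv x y; have := hm (x, y); simp only; linarith
    simpa using this
  have : ∫ _ : Y, (m - ∫ x, u x ∂μ) ∂ν ≤ ∫ y, v y ∂ν :=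
    integral_mono (integrable_const _) hv fun y => by have := h1 y; simp only; linarith
  simp at this
  linarith

theorem upperDualValues_bddBelow (μ : Measure X) (ν : Measure Y) [IsProbabilityMeasure μ]
    [IsProbabilityMeasure ν] (h : C(X × Y, ℝ)) : BddBelow (upperDualValues μ ν h) :=
  ⟨-‖h‖, fun _ ht => le_of_mem_upperDualValues
    (fun p => (abs_le.1 (h.norm_coe_le_norm p)).1) ht⟩

theorem upperDualValues_nonempty (μ : Measure X) (ν : Measure Y) [IsProbabilityMeasure μ]
    [IsProbabilityMeasure ν] (h : C(X × Y, ℝ)) : (upperDualValues μ ν h).Nonempty :=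
  ⟨‖h‖, upperDualValues_const_mem μ ν h _ fun p => (abs_le.1 (h.norm_coe_le_norm p)).2⟩

theorem add_mem_upperDualValues {μ : Measure X} {ν : Measure Y} [IsProbabilityMeasure μ]
    [IsProbabilityMeasure ν] {h k : C(X × Y, ℝ)} {a b : ℝ} (ha : a ∈ upperDualValues μ ν h)
    (hb : b ∈ upperDualValues μ ν k) : a + b ∈ upperDualValues μ ν (h + k) := by
  obtain ⟨u, v, huv, rfl⟩ := ha
  obtain ⟨u', v', huv', rfl⟩ := hb
  refine ⟨u + u', v + v', fun x y => ?_, ?_⟩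
  · have := huv x y; have := huv' x y; simp only [ContinuousMap.add_apply]; linarith
  · simp only [ContinuousMap.add_apply]
    rw [integral_add (u.integrable_of_compactSpace μ) (u'.integrable_of_compactSpace μ),
      integral_add (v.integrable_of_compactSpace ν) (v'.integrable_of_compactSpace ν)]
    ring

theorem smul_mem_upperDualValues {μ : Measure X} {ν : Measure Y} {h : C(X × Y, ℝ)} {a c : ℝ}
    (hc : 0 ≤ c) (ha : a ∈ upperDualValues μ ν h) : c * a ∈ upperDualValues μ ν (c • h) := by
  obtain ⟨u, v, huv, rfl⟩ := ha
  refine ⟨c • u, c • v, fun x y => ?_, ?_⟩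
  · simp only [ContinuousMap.smul_apply, smul_eq_mul, ← mul_add]
    exact mul_le_mul_of_nonneg_left (huv x y) hc
  · simp only [ContinuousMap.smul_apply, smul_eq_mul, integral_const_mul, mul_add]

/-- A linear functional on `C(X × Y)` dominated by the infimum of `upperDualValues` is
integration against a coupling. -/
theorem exists_coupling_of_le_sInf_upperDualValues (μ : Measure X) (ν : Measure Y)
    [IsProbabilityMeasure μ] [IsProbabilityMeasure ν] (g : C(X × Y, ℝ) →ₗ[ℝ] ℝ)
    (hg : ∀ h, g h ≤ sInf (upperDualValues μ ν h)) :
    ∃ γ : Measure (X × Y), γ.map Prod.fst = μ ∧ γ.map Prod.snd = ν ∧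
      ∀ h : C(X × Y, ℝ), ∫ p, h p ∂γ = g h := by
  have hle : ∀ h t, t ∈ upperDualValues μ ν h → g h ≤ t := fun h t ht =>
    (hg h).trans (csInf_le (upperDualValues_bddBelow μ ν h) ht)
  -- Domination of both `h` and `-h` forces equality on separated sums; this fixes the marginals.
  have hsplit : ∀ (u : C(X, ℝ)) (v : C(Y, ℝ)) (h : C(X × Y, ℝ)),
      (∀ x y, h (x, y) = u x + v y) → g h = ∫ x, u x ∂μ + ∫ y, v y ∂ν := fun u v h huv => by
    refine le_antisymm (hle _ _ ⟨u, v, fun x y => (huv x y).le, rfl⟩) ?_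
    have := hle (-h) _ ⟨-u, -v, fun x y => by simp [huv x y, add_comm], rfl⟩
    simp only [map_neg, ContinuousMap.neg_apply, integral_neg] at this
    linarith
  -- For `h ≥ 0` the constant `0` is a dual value of `-h`.
  have hpos : ∀ h : C(X × Y, ℝ), (∀ p, 0 ≤ h p) → 0 ≤ g h := fun h hh => by
    have := hle (-h) 0 (upperDualValues_const_mem μ ν _ 0 fun p => by simpa using hh p)
    simpa using this
  let Λ : CompactlySupportedContinuousMap (X × Y) ℝ →ₚ[ℝ] ℝ := PositiveLinearMap.mk₀
    { toFun := fun f => g f.toContinuousMap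
      map_add' := fun a b => by
        rw [← map_add]; rfl
      map_smul' := fun a b => by
        rw [RingHom.id_apply, ← map_smul]; rfl }
    (fun f hf => hpos _ fun p => hf p)
  have hΛ : ∀ h : C(X × Y, ℝ), ∫ p, h p ∂(RealRMK.rieszMeasure Λ) = g h := fun h =>
    RealRMK.integral_rieszMeasure Λ ⟨h, HasCompactSupport.of_compactSpace _⟩
  have : IsFiniteMeasure (RealRMK.rieszMeasure Λ) :=
    ⟨(isCompact_univ).measure_lt_top⟩
  refine ⟨RealRMK.rieszMeasure Λ, ?_, ?_, hΛ⟩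
  · refine ext_of_forall_integral_eq_of_IsFiniteMeasure fun f => ?_
    rw [integral_map measurable_fst.aemeasurable
      f.continuous.measurable.aestronglyMeasurable]
    have := hΛ (f.toContinuousMap.comp ContinuousMap.fst)
    have h2 := hsplit f.toContinuousMap 0 (f.toContinuousMap.comp ContinuousMap.fst) (by simp)
    rw [h2] at this
    simpa using this
  · refine ext_of_forall_integral_eq_of_IsFiniteMeasure fun f => ?_
    rw [integral_map measurable_snd.aemeasurable
      f.continuous.measurable.aestronglyMeasurable]
    have := hΛ (f.toContinuousMap.comp ContinuousMap.snd)
    have h2 := hsplit 0 f.toContinuousMap (f.toContinuousMap.comp ContinuousMap.snd) (by simp)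
    rw [h2] at this
    simpa using this

/-- **Kantorovich duality** on compact metric spaces, for continuous costs. -/
theorem exists_coupling_integral_le (μ : Measure X) (ν : Measure Y)
    [IsProbabilityMeasure μ] [IsProbabilityMeasure ν] (c : C(X × Y, ℝ)) (D : ℝ)
    (hD : ∀ (u : C(X, ℝ)) (v : C(Y, ℝ)), (∀ x y, u x + v y ≤ c (x, y)) →
      ∫ x, u x ∂μ + ∫ y, v y ∂ν ≤ D) :
    ∃ γ : Measure (X × Y), γ.map Prod.fst = μ ∧ γ.map Prod.snd = ν ∧ ∫ p, c p ∂γ ≤ D := by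
  -- `N` is sublinear. The extended functional takes the value `N (-c)` at `-c`, so its coupling has
  -- cost `-N (-c)`.
  let N : C(X × Y, ℝ) → ℝ := fun h => sInf (upperDualValues μ ν h)
  have N_hom_le : ∀ a : ℝ, 0 < a → ∀ h, N (a • h) ≤ a * N h := fun a ha h => by
    rw [← div_le_iff₀' ha]
    refine le_csInf (upperDualValues_nonempty μ ν h) fun t ht => ?_
    rw [div_le_iff₀' ha]
    exact csInf_le (upperDualValues_bddBelow _ _ _) (smul_mem_upperDualValues ha.le ht)
  have N_hom : ∀ a : ℝ, 0 < a → ∀ h, N (a • h) = a * N h := fun a ha h => by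
    refine le_antisymm (N_hom_le a ha h) ?_
    have := N_hom_le a⁻¹ (inv_pos.2 ha) (a • h)
    rwa [inv_smul_smul₀ ha.ne', le_inv_mul_iff₀ ha] at this
  have N_add : ∀ h k, N (h + k) ≤ N h + N k := fun h k => by
    rw [← sub_le_iff_le_add]
    refine le_csInf (upperDualValues_nonempty μ ν h) fun a ha => ?_
    rw [sub_le_comm]
    refine le_csInf (upperDualValues_nonempty μ ν k) fun b hb => ?_
    rw [sub_le_iff_le_add']
    exact csInf_le (upperDualValues_bddBelow _ _ _) (add_mem_upperDualValues ha hb)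
  have N_zero : N 0 = 0 := by
    have := N_hom 2 two_pos 0
    rw [smul_zero] at this
    linarith
  have hx : -c = 0 → N (-c) = 0 := fun h => by rw [h, N_zero]
  let f := LinearPMap.mkSpanSingleton' (σ := RingHom.id ℝ) (-c) (N (-c)) fun a ha => by
    rcases smul_eq_zero.1 ha with h | h
    · simp [h]
    · simp [hx h]
  obtain ⟨g, hgf, hgN⟩ := exists_extension_of_le_sublinear f N N_hom N_add (by
    rintro ⟨x, hx⟩
    obtain ⟨a, rfl⟩ := Submodule.mem_span_singleton.1 hx
    rw [LinearPMap.mkSpanSingleton'_apply]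
    simp only [RingHom.id_apply, smul_eq_mul]
    rcases lt_trichotomy a 0 with ha | rfl | ha
    -- For negative `a`, subadditivity and `N 0 = 0` give `-N (-x) ≤ N x`.
    · have h1 := N_add (a • (-c)) ((-a) • (-c))
      rw [← add_smul, add_neg_cancel, zero_smul, N_zero, N_hom (-a) (by linarith)] at h1
      linarith
    · simp [N_zero]
    · exact (N_hom a ha _).ge)
  obtain ⟨γ, h1, h2, h3⟩ := exists_coupling_of_le_sInf_upperDualValues μ ν g hgN
  refine ⟨γ, h1, h2, ?_⟩
  have h4 : g (-c) = N (-c) := by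
    rw [hgf ⟨-c, Submodule.mem_span_singleton_self _⟩]
    exact LinearPMap.mkSpanSingleton'_apply_self _ _ _ _
  rw [h3 c]
  -- Negating a pair that dominates `-c` gives a pair admissible for `hD`.
  have h5 : -D ≤ N (-c) := by
    refine le_csInf (upperDualValues_nonempty μ ν _) ?_
    rintro t ⟨u, v, huv, rfl⟩
    have := hD (-u) (-v) fun x y => by
      have := huv x y
      simp only [ContinuousMap.neg_apply] at this ⊢
      linarith
    simp only [ContinuousMap.neg_apply, integral_neg] at this
    linarith
  rw [map_neg] at h4
  linarith

end Kantorovich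

/-! ### Hölder functions and Kantorovich-Rubinstein duality -/

theorem HolderWith.of_dist_le {X Y : Type*} [PseudoMetricSpace X] [PseudoMetricSpace Y]
    {C r : ℝ≥0} {f : X → Y} (h : ∀ x y, dist (f x) (f y) ≤ C * dist x y ^ (r : ℝ)) :
    HolderWith C r f := fun x y => by
  rw [edist_dist, edist_dist, ENNReal.ofReal_rpow_of_nonneg dist_nonneg r.coe_nonneg,
    ← ENNReal.ofReal_coe_nnreal, ← ENNReal.ofReal_mul C.coe_nonneg]
  exact ENNReal.ofReal_le_ofReal (h x y)

theorem HolderWith.edist_one_le {X Y : Type*} [PseudoEMetricSpace X] [PseudoEMetricSpace Y]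
    {r : ℝ≥0} {f : X → Y} (h : HolderWith 1 r f) (x y : X) :
    edist (f x) (f y) ≤ edist x y ^ (r : ℝ) := by
  simpa using h x y

theorem HolderWith.dist_one_le {X Y : Type*} [PseudoMetricSpace X] [PseudoMetricSpace Y]
    {r : ℝ≥0} {f : X → Y} (h : HolderWith 1 r f) (x y : X) :
    dist (f x) (f y) ≤ dist x y ^ (r : ℝ) := by
  simpa using h.dist_le x y

/-- The inf-convolution of a bounded below function on a subset with the metric `dist ^ s`. -/
theorem exists_holderWith_infConvolution {X : Type*} [PseudoMetricSpace X] {s : ℝ≥0}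
    (hs : s ≤ 1) {K : Set X} [Nonempty K] (w : K → ℝ) (hw : BddBelow (range w)) :
    ∃ f : X → ℝ, HolderWith 1 s f ∧ (∀ x (y : K), f x ≤ dist x (y : X) ^ (s : ℝ) + w y) ∧
      ∀ x t, (∀ y : K, t ≤ dist x (y : X) ^ (s : ℝ) + w y) → t ≤ f x := by
  obtain ⟨m, hm⟩ := hw
  have hb : ∀ x : X, BddBelow (range fun y : K => dist x (y : X) ^ (s : ℝ) + w y) := fun x =>
    ⟨m, by
      rintro _ ⟨y, rfl⟩
      have h1 : m ≤ w y := hm ⟨y, rfl⟩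
      have h2 : 0 ≤ dist x (y : X) ^ (s : ℝ) := by positivity
      simp only
      linarith⟩
  let f : X → ℝ := fun x => ⨅ y : K, dist x (y : X) ^ (s : ℝ) + w y
  have hle : ∀ x x', f x ≤ f x' + dist x x' ^ (s : ℝ) := fun x x' => by
    rw [← sub_le_iff_le_add]
    refine le_ciInf fun y => ?_
    rw [sub_le_iff_le_add]
    refine (ciInf_le (hb x) y).trans ?_
    have h1 : dist x (y : X) ^ (s : ℝ) ≤ (dist x x' + dist x' y) ^ (s : ℝ) :=
      Real.rpow_le_rpow dist_nonneg (dist_triangle _ _ _) s.coe_nonneg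
    -- Here `s ≤ 1` enters: `t ↦ t^s` is subadditive, so `dist ^ s` satisfies the triangle
    -- inequality.
    have h2 := Real.rpow_add_le_add_rpow (dist_nonneg (x := x) (y := x'))
      (dist_nonneg (x := x') (y := (y : X))) s.coe_nonneg (by exact_mod_cast hs)
    linarith
  refine ⟨f, HolderWith.of_dist_le fun x x' => ?_, fun x y => ciInf_le (hb x) y,
    fun x t h => le_ciInf h⟩
  have h1 := hle x x'
  have h2 := hle x' x
  rw [dist_comm x' x] at h2
  rw [Real.dist_eq, abs_le, NNReal.coe_one, one_mul]
  constructor <;> linarith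

/-- The easy half of duality: along any coupling, `‖f x - f y‖` is at most the cost. Complex values
cause no loss. -/
theorem enorm_integral_sub_integral_le_wassersteinDist {n : ℕ} {s : ℝ≥0} {μ ν : Measure (Rn n)}
    {f : Rn n → ℂ} (hf : HolderWith 1 s f) (hμ : Integrable f μ) (hν : Integrable f ν) :
    ‖∫ x, f x ∂μ - ∫ x, f x ∂ν‖ₑ ≤ wassersteinDist s μ ν := by
  refine le_iInf fun γ => le_iInf fun h1 => le_iInf fun h2 => ?_
  subst h1 h2
  have i1 : Integrable (fun p : Rn n × Rn n => f p.1) γ := hμ.comp_measurable measurable_fst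
  have i2 : Integrable (fun p : Rn n × Rn n => f p.2) γ := hν.comp_measurable measurable_snd
  rw [integral_map measurable_fst.aemeasurable hμ.1, integral_map measurable_snd.aemeasurable hν.1,
    ← integral_sub i1 i2]
  refine (enorm_integral_le_lintegral_enorm _).trans (lintegral_mono fun p => ?_)
  rw [← edist_eq_enorm_sub]
  exact hf.edist_one_le _ _

/-- The difficult half of Kantorovich-Rubinstein duality for the metric `|x - y| ^ s`. -/
theorem wassersteinDist_le_of_forall_holderWith {n : ℕ} {s : ℝ≥0} (hs0 : 0 < s) (hs : s ≤ 1)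
    {K : Set (Rn n)} (hK : IsCompact K) {μ ν : Measure (Rn n)} [IsProbabilityMeasure μ]
    [IsProbabilityMeasure ν] (hμ : μ Kᶜ = 0) (hν : ν Kᶜ = 0) {D : ℝ}
    (hD : ∀ f : Rn n → ℝ, HolderWith 1 s f → f 0 = 0 → ∫ x, f x ∂μ - ∫ x, f x ∂ν ≤ D) :
    wassersteinDist s μ ν ≤ ENNReal.ofReal D := by
  have hKm := hK.measurableSet
  have : CompactSpace K := isCompact_iff_compactSpace.1 hK
  have hμr : μ.restrict K = μ := Measure.restrict_eq_self_of_ae_mem (mem_ae_iff.2 hμ)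
  have hνr : ν.restrict K = ν := Measure.restrict_eq_self_of_ae_mem (mem_ae_iff.2 hν)
  have hμ' := map_comap_subtype_coe hKm μ
  have hν' := map_comap_subtype_coe hKm ν
  rw [hμr] at hμ'
  rw [hνr] at hν'
  have hpm : ∀ {ρ : Measure (Rn n)} [IsProbabilityMeasure ρ],
      (ρ.comap (Subtype.val : K → Rn n)).map Subtype.val = ρ →
      IsProbabilityMeasure (ρ.comap (Subtype.val : K → Rn n)) := fun {ρ} _ h => by
    constructor
    have h1 : ρ univ = 1 := measure_univ
    rw [← h, Measure.map_apply measurable_subtype_coe MeasurableSet.univ, preimage_univ] at h1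
    exact h1
  have := hpm hμ'
  have := hpm hν'
  have : Nonempty K := by
    by_contra hne
    have he : K = ∅ := not_nonempty_iff_eq_empty.1 fun h => hne h.to_subtype
    rw [he, compl_empty, measure_univ] at hμ
    exact one_ne_zero hμ
  let c : C(K × K, ℝ) := ⟨fun p => dist (p.1 : Rn n) (p.2 : Rn n) ^ (s : ℝ), by
    refine Continuous.rpow_const (by fun_prop) fun _ => Or.inr s.coe_nonneg⟩
  obtain ⟨γ, h1, h2, h3⟩ := exists_coupling_integral_le (μ.comap (Subtype.val : K → Rn n))
    (ν.comap (Subtype.val : K → Rn n)) c D (fun u v huv => by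
      -- With `f x = inf_y (|x - y|^s - v y)`, admissibility of the pair gives `u ≤ f` on `K`, and
      -- the choice `y = x` gives `v ≤ -f`. One Hölder function thus does at least as well as the
      -- pair.
      obtain ⟨f, hf, hfle, hlef⟩ := exists_holderWith_infConvolution hs (fun y : K => -v y)
        (isCompact_range (by fun_prop)).bddBelow
      have hfc : Continuous f := hf.continuous hs0
      have hfi : ∀ (ρ : Measure K) [IsFiniteMeasure ρ], Integrable (fun x : K => f x) ρ :=
        fun ρ _ => ContinuousMap.integrable_of_compactSpace ρ
          ⟨fun x : K => f x, hfc.comp continuous_subtype_val⟩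
      have e1 : ∫ x, u x ∂(μ.comap (Subtype.val : K → Rn n)) ≤ ∫ x, f x ∂μ := by
        rw [← hμr, ← integral_subtype_comap hKm, hμr]
        refine integral_mono (u.integrable_of_compactSpace _) (hfi _) fun x => ?_
        refine hlef _ _ fun y => ?_
        have := huv x y
        change u x + v y ≤ dist (x : Rn n) (y : Rn n) ^ (s : ℝ) at this
        linarith
      have e2 : ∫ x, v x ∂(ν.comap (Subtype.val : K → Rn n)) ≤ - ∫ x, f x ∂ν := by
        rw [← hνr, ← integral_subtype_comap hKm, hνr, ← integral_neg]
        refine integral_mono (v.integrable_of_compactSpace _) (hfi _).neg fun x => ?_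
        have := hfle x x
        rw [dist_self, Real.zero_rpow (by exact_mod_cast hs0.ne')] at this
        simp only
        linarith
      have hfi' : ∀ (ρ : Measure (Rn n)) [IsProbabilityMeasure ρ], ρ.restrict K = ρ →
          Integrable f ρ := fun ρ _ h => by
        rw [← h]
        exact hfc.continuousOn.integrableOn_compact hK
      -- Normalizing `f` at the origin is harmless because both measures have mass one.
      have e3 := hD (fun x => f x - f 0) (HolderWith.of_dist_le fun x y => by
        rw [dist_sub_right]; simpa using hf.dist_one_le x y) (sub_self _)
      rw [integral_sub (hfi' μ hμr) (integrable_const _),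
        integral_sub (hfi' ν hνr) (integrable_const _)] at e3
      simp only [integral_const, probReal_univ, one_smul] at e3
      linarith)
  have hval : Measurable (Prod.map (Subtype.val : K → Rn n) (Subtype.val : K → Rn n)) := by
    fun_prop
  have hfin : IsFiniteMeasure γ := by
    constructor
    have := congrArg (fun ρ => ρ univ) h1
    simp only [Measure.map_apply measurable_fst MeasurableSet.univ, preimage_univ,
      measure_univ] at this
    rw [this]
    exact ENNReal.one_lt_top
  refine iInf_le_of_le (γ.map (Prod.map Subtype.val Subtype.val)) (iInf₂_le_of_le ?_ ?_ ?_)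
  · rw [Measure.map_map measurable_fst hval, ← hμ', ← h1,
      Measure.map_map measurable_subtype_coe measurable_fst]
    rfl
  · rw [Measure.map_map measurable_snd hval, ← hν', ← h2,
      Measure.map_map measurable_subtype_coe measurable_snd]
    rfl
  · rw [lintegral_map (by fun_prop) hval]
    refine le_trans (le_of_eq ?_) (ENNReal.ofReal_le_ofReal h3)
    rw [ofReal_integral_eq_lintegral_ofReal (c.integrable_of_compactSpace γ)
      (Filter.Eventually.of_forall fun p => Real.rpow_nonneg dist_nonneg _)]
    refine lintegral_congr fun p => ?_
    rw [edist_dist, ENNReal.ofReal_rpow_of_nonneg dist_nonneg s.coe_nonneg]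
    rfl

/-! ### The dual Hölder norm and its scaling -/

theorem enorm_integral_le_holderDualNorm {n : ℕ} {s : ℝ≥0} {f : Rn n → ℂ} (g : Rn n → ℂ)
    (hf : HolderWith 1 s f) (h0 : f 0 = 0) : ‖∫ x, f x * g x‖ₑ ≤ holderDualNorm s g :=
  le_iSup_of_le f (le_iSup₂_of_le hf h0 le_rfl)

/-- The normalization `f 0 = 0` gives `‖f x‖ ≤ ‖x‖^s`, so `‖x‖^s ‖g x‖` is an integrable majorant
common to all test functions. -/
theorem holderDualNorm_lt_top {n : ℕ} (s : ℝ≥0) {g : Rn n → ℂ} (hg : Continuous g)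
    (hgc : HasCompactSupport g) : holderDualNorm s g < ∞ := by
  let w : Rn n → ℝ := fun x => ‖x‖ ^ (s : ℝ) * ‖g x‖
  have hw : Continuous w :=
    (Continuous.rpow_const continuous_norm fun _ => Or.inr s.coe_nonneg).mul hg.norm
  have hwi : Integrable w := hw.integrable_of_hasCompactSupport hgc.norm.mul_left
  refine lt_of_le_of_lt ?_ hwi.2
  refine iSup_le fun f => iSup₂_le fun hf h0 => ?_
  refine (enorm_integral_le_lintegral_enorm _).trans (lintegral_mono fun x => ?_)
  rw [enorm_le_iff_norm_le, norm_mul, Real.norm_of_nonneg (by positivity)]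
  refine mul_le_mul_of_nonneg_right ?_ (norm_nonneg _)
  simpa [h0] using hf.dist_one_le x 0

theorem LipschitzWith.exists_holderWith_of_hasCompactSupport {n : ℕ} {g : Rn n → ℂ} {L : ℝ≥0}
    (hg : LipschitzWith L g) (hgc : HasCompactSupport g) {s : ℝ≥0} (hs : s ≤ 1) :
    ∃ M, HolderWith M s g := by
  obtain ⟨B, hB⟩ := hgc.exists_bound_of_continuous hg.continuous
  have hB0 : 0 ≤ B := (norm_nonneg _).trans (hB 0)
  -- Boundedness is the Hölder condition of exponent `0`; interpolate it with the Lipschitz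
  -- condition of exponent `1`.
  have h0 : HolderWith (2 * B).toNNReal 0 g := HolderWith.of_dist_le fun x y => by
    rw [NNReal.coe_zero, Real.rpow_zero, mul_one, Real.coe_toNNReal _ (by linarith)]
    have := dist_le_norm_add_norm (g x) (g y)
    linarith [hB x, hB y]
  exact ⟨_, h0.of_le_of_le (holderWith_one.2 hg) zero_le hs⟩

/-- Test against a multiple of `g - g 0`; the constant disappears because `g` has mean zero. -/
theorem holderDualNorm_pos {n : ℕ} {s : ℝ≥0} (hs : s ≤ 1) {g : Rn n → ℂ} {L : ℝ≥0}
    (hg : LipschitzWith L g) (hgc : HasCompactSupport g) (hmean : ∫ x, g x = 0)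
    (hsq : ∫ x, g x * g x ≠ 0) : 0 < holderDualNorm s g := by
  obtain ⟨M, hM⟩ := hg.exists_holderWith_of_hasCompactSupport hgc hs
  -- The shift by one permits division even when `M = 0`.
  have hM0 : (0 : ℝ) < M + 1 := by positivity
  let f : Rn n → ℂ := fun x => ((M + 1 : ℝ)⁻¹ : ℂ) * (g x - g 0)
  have hf : HolderWith 1 s f := HolderWith.of_dist_le fun x y => by
    have h1 := hM.dist_le x y
    have h2 : 0 ≤ dist x y ^ (s : ℝ) := by positivity
    have h3 : dist (f x) (f y) = (M + 1 : ℝ)⁻¹ * dist (g x) (g y) := by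
      rw [dist_eq_norm, dist_eq_norm, ← mul_sub, sub_sub_sub_cancel_right, norm_mul, norm_inv]
      congr 2
      rw [Complex.norm_real, Real.norm_of_nonneg hM0.le]
    rw [h3, NNReal.coe_one, one_mul, inv_mul_le_iff₀ hM0]
    linarith
  refine lt_of_lt_of_le ?_ (enorm_integral_le_holderDualNorm g hf (by simp [f]))
  have hgi : Integrable g := hg.continuous.integrable_of_hasCompactSupport hgc
  have hggi : Integrable fun x => g x * g x :=
    (hg.continuous.mul hg.continuous).integrable_of_hasCompactSupport hgc.mul_left
  have : ∫ x, f x * g x = ((M + 1 : ℝ)⁻¹ : ℂ) * ∫ x, g x * g x := by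
    simp only [f, mul_assoc, sub_mul]
    rw [integral_const_mul, integral_sub hggi (hgi.const_mul _), integral_const_mul, hmean,
      mul_zero, sub_zero]
  rw [this, enorm_pos]
  refine mul_ne_zero (inv_ne_zero ?_) hsq
  exact_mod_cast hM0.ne'

theorem holderDualNorm_const_mul {n : ℕ} (s : ℝ≥0) (c : ℂ) (g : Rn n → ℂ) :
    holderDualNorm s (fun x => c * g x) = ‖c‖ₑ * holderDualNorm s g := by
  simp only [holderDualNorm, ENNReal.mul_iSup]
  refine iSup_congr fun f => iSup_congr fun _ => iSup_congr fun _ => ?_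
  rw [← enorm_mul, ← integral_const_mul]
  simp only [mul_left_comm]

theorem integral_comp_smul_sub {n : ℕ} {a : ℝ} (ha : 0 < a) (b : Rn n) (H : Rn n → ℂ) :
    ∫ x, H (a • x - b) = ((a ^ n)⁻¹ : ℝ) * ∫ x, H x := by
  rw [Measure.integral_comp_smul volume (fun y => H (y - b)) a, integral_sub_right_eq_self,
    finrank_euclideanSpace_fin, abs_of_pos (by positivity), Complex.real_smul]

/-- Substituting `y = a x - b` costs the Jacobian `a^(-n)` and turns `f` into a function with Hölder
constant `a^(-s)`. Mean zero allows it to be renormalized at the origin. -/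
theorem holderDualNorm_comp_smul_sub_le {n : ℕ} {s : ℝ≥0} (hs : 0 < s) {g : Rn n → ℂ}
    (hg : Continuous g) (hgc : HasCompactSupport g) (hmean : ∫ x, g x = 0) {a : ℝ} (ha : 0 < a)
    (b : Rn n) :
    holderDualNorm s (fun x => g (a • x - b)) ≤
      ENNReal.ofReal ((a ^ n)⁻¹ * (a ^ (s : ℝ))⁻¹) * holderDualNorm s g := by
  refine iSup_le fun f => iSup₂_le fun hf h0 => ?_
  have has : 0 < a ^ (s : ℝ) := Real.rpow_pos_of_pos ha _
  let F : Rn n → ℂ := fun y => ((a ^ (s : ℝ) : ℝ) : ℂ) * (f (a⁻¹ • (y + b)) - f (a⁻¹ • b))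
  have hF : HolderWith 1 s F := HolderWith.of_dist_le fun x y => by
    rw [dist_eq_norm, ← mul_sub, sub_sub_sub_cancel_right, norm_mul, Complex.norm_real,
      Real.norm_of_nonneg has.le, ← dist_eq_norm, NNReal.coe_one, one_mul]
    refine (mul_le_mul_of_nonneg_left (hf.dist_one_le _ _) has.le).trans_eq ?_
    rw [dist_smul₀, dist_add_right, norm_inv, Real.norm_of_nonneg ha.le,
      Real.mul_rpow (by positivity) dist_nonneg, Real.inv_rpow ha.le,
      mul_inv_cancel_left₀ has.ne']
  have hfc : Continuous f := hf.continuous hs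
  have hi : Integrable fun y => f (a⁻¹ • (y + b)) * g y :=
    (Continuous.mul (hfc.comp (by fun_prop)) hg).integrable_of_hasCompactSupport hgc.mul_left
  have hgi : Integrable g := hg.integrable_of_hasCompactSupport hgc
  have h1 : ∫ x, F x * g x = ((a ^ (s : ℝ) : ℝ) : ℂ) * ∫ y, f (a⁻¹ • (y + b)) * g y := by
    simp only [F, mul_assoc, sub_mul]
    rw [integral_const_mul, integral_sub hi (hgi.const_mul _), integral_const_mul, hmean,
      mul_zero, sub_zero]
  have h2 : ∫ x, f x * g (a • x - b) = ((a ^ n)⁻¹ : ℝ) * ∫ y, f (a⁻¹ • (y + b)) * g y := by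
    rw [← integral_comp_smul_sub ha b (fun y => f (a⁻¹ • (y + b)) * g y)]
    simp only [sub_add_cancel, inv_smul_smul₀ ha.ne']
  have h3 : ∫ x, f x * g (a • x - b) =
      (((a ^ n)⁻¹ * (a ^ (s : ℝ))⁻¹ : ℝ) : ℂ) * ∫ x, F x * g x := by
    rw [h1, h2, ← mul_assoc, ← Complex.ofReal_mul, inv_mul_cancel_right₀ has.ne']
  rw [h3, enorm_mul]
  gcongr
  · rw [← ofReal_norm, Complex.norm_real, Real.norm_of_nonneg (by positivity)]
  · exact enorm_integral_le_holderDualNorm g hF (by simp [F])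

theorem HasCompactSupport.comp_smul_sub {n : ℕ} {g : Rn n → ℂ} (hgc : HasCompactSupport g)
    {a : ℝ} (ha : a ≠ 0) (b : Rn n) : HasCompactSupport fun x => g (a • x - b) :=
  hgc.comp_homeomorph ((Homeomorph.smulOfNeZero a ha).trans (Homeomorph.subRight b))

theorem holderDualNorm_comp_smul_sub {n : ℕ} {s : ℝ≥0} (hs : 0 < s) {g : Rn n → ℂ}
    (hg : Continuous g) (hgc : HasCompactSupport g) (hmean : ∫ x, g x = 0) {a : ℝ} (ha : 0 < a)
    (b : Rn n) :
    holderDualNorm s (fun x => g (a • x - b)) =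
      ENNReal.ofReal ((a ^ n)⁻¹ * (a ^ (s : ℝ))⁻¹) * holderDualNorm s g := by
  refine le_antisymm (holderDualNorm_comp_smul_sub_le hs hg hgc hmean ha b) ?_
  -- The reverse bound is the same inequality for the inverse affine map.
  have h := holderDualNorm_comp_smul_sub_le (g := fun x => g (a • x - b)) hs (by fun_prop)
    (hgc.comp_smul_sub ha.ne' b) (by rw [integral_comp_smul_sub ha, hmean, mul_zero])
    (inv_pos.2 ha) (-(a⁻¹ • b))
  have h1 : (fun x => g (a • (a⁻¹ • x - -(a⁻¹ • b)) - b)) = g := by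
    funext x
    rw [sub_neg_eq_add, ← smul_add, smul_inv_smul₀ ha.ne', add_sub_cancel_right]
  rw [h1] at h
  have has : 0 < a ^ (s : ℝ) := Real.rpow_pos_of_pos ha _
  calc _ ≤ _ := mul_le_mul_right h _
    _ = _ := by
      rw [← mul_assoc, ← ENNReal.ofReal_mul (by positivity), Real.inv_rpow ha.le]
      have : (a ^ n)⁻¹ * (a ^ (s : ℝ))⁻¹ * (((a⁻¹) ^ n)⁻¹ * ((a ^ (s : ℝ))⁻¹)⁻¹) = 1 := by
        rw [inv_pow]
        field_simp
      rw [this, ENNReal.ofReal_one, one_mul]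

/-- The exponent collects `nj/2` from the amplitude, `-nj` from the Jacobian and `-js` from the
Hölder constant. -/
theorem holderDualNorm_dilate {n : ℕ} {s : ℝ≥0} (hs : 0 < s) {g : Rn n → ℂ}
    (hg : Continuous g) (hgc : HasCompactSupport g) (hmean : ∫ x, g x = 0) (j : ℤ)
    (k : Fin n → ℤ) :
    holderDualNorm s (dilate g j k) =
      ENNReal.ofReal ((2 : ℝ) ^ (-(j : ℝ) * ((s : ℝ) + (n : ℝ) / 2))) * holderDualNorm s g := by
  have h2 : (0 : ℝ) < 2 := two_pos
  change holderDualNorm s (fun x => _ * g ((2 : ℝ) ^ j • x - latticeVec k)) = _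
  rw [holderDualNorm_const_mul s _ (fun x => g ((2 : ℝ) ^ j • x - latticeVec k)),
    holderDualNorm_comp_smul_sub hs hg hgc hmean (zpow_pos h2 j), ← mul_assoc]
  congr 1
  rw [← ofReal_norm, Complex.norm_real, Real.norm_of_nonneg (by positivity),
    ← ENNReal.ofReal_mul (by positivity), ← Real.rpow_intCast, ← Real.rpow_natCast,
    ← Real.rpow_mul h2.le, ← Real.rpow_mul h2.le, ← Real.rpow_neg h2.le, ← Real.rpow_neg h2.le,
    ← Real.rpow_add h2, ← Real.rpow_add h2]
  congr 2
  ring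

/-! ### The measures built from the parts of a function -/

theorem hasCompactSupport_posPart_re {n : ℕ} {g : Rn n → ℂ} (hgc : HasCompactSupport g) :
    HasCompactSupport fun x => (g x).re⁺ :=
  hgc.comp_left (g := fun z : ℂ => z.re⁺) (by simp)

theorem hasCompactSupport_negPart_re {n : ℕ} {g : Rn n → ℂ} (hgc : HasCompactSupport g) :
    HasCompactSupport fun x => (g x).re⁻ :=
  hgc.comp_left (g := fun z : ℂ => z.re⁻) (by simp)

theorem continuous_posPart_re {n : ℕ} {g : Rn n → ℂ} (hg : Continuous g) :
    Continuous fun x => (g x).re⁺ := by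
  simp only [posPart_def]; fun_prop

theorem continuous_negPart_re {n : ℕ} {g : Rn n → ℂ} (hg : Continuous g) :
    Continuous fun x => (g x).re⁻ := by
  simp only [negPart_def]; fun_prop

theorem isAb2On_withDensity {n : ℕ} {K : Set (Rn n)} {p : Rn n → ℝ} (hp : Continuous p)
    (hpc : HasCompactSupport p) (hp0 : ∀ x, 0 ≤ p x) (hpK : ∀ x ∉ K, p x = 0)
    (hKm : MeasurableSet K) (h1 : ∫ x, p x = 1) :
    IsAb2On K (volume.withDensity fun x => ENNReal.ofReal (p x)) where
  isProbability := ⟨by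
    rw [withDensity_apply _ MeasurableSet.univ, Measure.restrict_univ,
      ← ofReal_integral_eq_lintegral_ofReal (hp.integrable_of_hasCompactSupport hpc)
        (Filter.Eventually.of_forall hp0), h1, ENNReal.ofReal_one]⟩
  concentrated := by
    rw [withDensity_apply _ hKm.compl]
    refine (setLIntegral_congr_fun hKm.compl fun x hx => ?_).trans lintegral_zero
    simp [hpK x hx]
  absolutelyContinuous := withDensity_absolutelyContinuous _ _
  sq_integrable := by
    refine (memLp_congr_ae ?_).1 (hp.memLp_of_hasCompactSupport hpc)
    filter_upwards [Measure.rnDeriv_withDensity volume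
      (f := fun x => ENNReal.ofReal (p x)) (by fun_prop)] with x hx
    rw [hx, ENNReal.toReal_ofReal (hp0 x)]

theorem isAb2On_posMeasure {n : ℕ} {K : Set (Rn n)} (hK : IsCompact K) {g : Rn n → ℂ}
    (hg : Continuous g) (hgK : tsupport g ⊆ K) {C : ℝ} (hC : 0 < C)
    (hint : ∫ x, (g x).re⁺ = C) : IsAb2On K (posMeasure g C) := by
  have hgc : HasCompactSupport g := hK.of_isClosed_subset (isClosed_tsupport g) hgK
  refine isAb2On_withDensity ((continuous_posPart_re hg).div_const C) ?_
    (fun x => div_nonneg (posPart_nonneg _) hC.le) (fun x hx => ?_) hK.measurableSet ?_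
  · exact (hasCompactSupport_posPart_re hgc).comp_left (g := fun t => t / C) (zero_div _)
  · simp [image_eq_zero_of_notMem_tsupport fun h => hx (hgK h)]
  · rw [integral_div, hint, div_self hC.ne']

theorem isAb2On_negMeasure {n : ℕ} {K : Set (Rn n)} (hK : IsCompact K) {g : Rn n → ℂ}
    (hg : Continuous g) (hgK : tsupport g ⊆ K) {C : ℝ} (hC : 0 < C)
    (hint : ∫ x, (g x).re⁻ = C) : IsAb2On K (negMeasure g C) := by
  have hgc : HasCompactSupport g := hK.of_isClosed_subset (isClosed_tsupport g) hgK
  refine isAb2On_withDensity ((continuous_negPart_re hg).div_const C) ?_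
    (fun x => div_nonneg (negPart_nonneg _) hC.le) (fun x hx => ?_) hK.measurableSet ?_
  · exact (hasCompactSupport_negPart_re hgc).comp_left (g := fun t => t / C) (zero_div _)
  · simp [image_eq_zero_of_notMem_tsupport fun h => hx (hgK h)]
  · rw [integral_div, hint, div_self hC.ne']

theorem densityDiff_posMeasure_negMeasure {n : ℕ} {g : Rn n → ℂ} (hg : Continuous g)
    (hreal : ∀ x, (g x).im = 0) {C : ℝ} (hC : 0 < C) :
    densityDiff (posMeasure g C) (negMeasure g C) =ᵐ[volume] fun x => (C : ℂ)⁻¹ * g x := by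
  have hp := continuous_posPart_re hg
  have hn := continuous_negPart_re hg
  filter_upwards [Measure.rnDeriv_withDensity volume
      (f := fun x => ENNReal.ofReal ((g x).re⁺ / C)) (by fun_prop),
    Measure.rnDeriv_withDensity volume
      (f := fun x => ENNReal.ofReal ((g x).re⁻ / C)) (by fun_prop)] with x h1 h2
  rw [densityDiff, posMeasure, negMeasure, h1, h2,
    ENNReal.toReal_ofReal (div_nonneg (posPart_nonneg _) hC.le),
    ENNReal.toReal_ofReal (div_nonneg (negPart_nonneg _) hC.le), ← sub_div,
    posPart_sub_negPart]
  have : g x = ((g x).re : ℂ) := Complex.ext rfl (by simp [hreal])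
  rw [this]
  push_cast
  rw [Complex.ofReal_re, div_eq_inv_mul]

theorem integral_withDensity_ofReal_div {n : ℕ} {p : Rn n → ℝ} (hp : Continuous p)
    (hp0 : ∀ x, 0 ≤ p x) {C : ℝ} (hC : 0 < C) (f : Rn n → ℂ) :
    ∫ x, f x ∂(volume.withDensity fun x => ENNReal.ofReal (p x / C)) =
      (C : ℂ)⁻¹ * ∫ x, f x * p x := by
  rw [integral_withDensity_eq_integral_toReal_smul (by fun_prop)
    (Filter.Eventually.of_forall fun x => ENNReal.ofReal_lt_top), ← integral_const_mul]
  refine integral_congr_ae (Filter.Eventually.of_forall fun x => ?_)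
  simp only
  rw [ENNReal.toReal_ofReal (div_nonneg (hp0 x) hC.le), Complex.real_smul]
  push_cast
  ring

theorem integral_posMeasure_sub_integral_negMeasure {n : ℕ} {g : Rn n → ℂ} (hg : Continuous g)
    (hgc : HasCompactSupport g) (hreal : ∀ x, (g x).im = 0) {C : ℝ} (hC : 0 < C)
    {f : Rn n → ℂ} (hf : Continuous f) :
    ∫ x, f x ∂(posMeasure g C) - ∫ x, f x ∂(negMeasure g C) =
      (C : ℂ)⁻¹ * ∫ x, f x * g x := by
  have hp := continuous_posPart_re hg
  have hn := continuous_negPart_re hg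
  rw [posMeasure, negMeasure, integral_withDensity_ofReal_div hp (fun x => posPart_nonneg _) hC,
    integral_withDensity_ofReal_div hn (fun x => negPart_nonneg _) hC, ← mul_sub,
    ← integral_sub]
  · congr 2
    funext x
    have : g x = ((g x).re : ℂ) := Complex.ext rfl (by simp [hreal])
    rw [← mul_sub, ← Complex.ofReal_sub, posPart_sub_negPart, ← this]
  · exact Continuous.integrable_of_hasCompactSupport (by fun_prop)
      ((hasCompactSupport_posPart_re hgc).comp_left Complex.ofReal_zero).mul_left
  · exact Continuous.integrable_of_hasCompactSupport (by fun_prop)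
      ((hasCompactSupport_negPart_re hgc).comp_left Complex.ofReal_zero).mul_left

theorem IsAb2On.integrable {n : ℕ} {K : Set (Rn n)} {μ : Measure (Rn n)} (hμ : IsAb2On K μ)
    (hK : IsCompact K) {f : Rn n → ℂ} (hf : Continuous f) : Integrable f μ := by
  have := hμ.isProbability
  rw [← Measure.restrict_eq_self_of_ae_mem (mem_ae_iff.2 hμ.concentrated)]
  exact hf.continuousOn.integrableOn_compact hK

/-- The upper bound uses only real test functions, which are among the complex ones; the lower bound
holds for complex test functions directly. Hence for real `g` the complex supremum is the
Wasserstein value. -/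
theorem wassersteinDist_posMeasure_negMeasure {n : ℕ} {s : ℝ≥0} (hs0 : 0 < s) (hs : s ≤ 1)
    {K : Set (Rn n)} (hK : IsCompact K) {g : Rn n → ℂ} (hg : Continuous g)
    (hgc : HasCompactSupport g) (hreal : ∀ x, (g x).im = 0) {C : ℝ} (hC : 0 < C)
    (hpos : IsAb2On K (posMeasure g C)) (hneg : IsAb2On K (negMeasure g C)) :
    wassersteinDist s (posMeasure g C) (negMeasure g C) =
      ENNReal.ofReal C⁻¹ * holderDualNorm s g := by
  have hCe : ‖(C : ℂ)⁻¹‖ₑ = ENNReal.ofReal C⁻¹ := by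
    rw [← ofReal_norm, norm_inv, Complex.norm_real, Real.norm_of_nonneg hC.le]
  have hfin := holderDualNorm_lt_top s hg hgc
  apply le_antisymm
  · have := hpos.isProbability
    have := hneg.isProbability
    have key := wassersteinDist_le_of_forall_holderWith (D := C⁻¹ * (holderDualNorm s g).toReal)
      hs0 hs hK hpos.concentrated hneg.concentrated (fun f hf h0 => ?_)
    · rwa [ENNReal.ofReal_mul (by positivity), ENNReal.ofReal_toReal hfin.ne] at key
    · have hF : HolderWith 1 s fun x => (f x : ℂ) := HolderWith.of_dist_le fun x y => by
        rw [Complex.dist_of_im_eq (by simp)]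
        simpa using hf.dist_one_le x y
      have h1 := integral_posMeasure_sub_integral_negMeasure hg hgc hreal hC (hF.continuous hs0)
      rw [integral_complex_ofReal, integral_complex_ofReal, ← Complex.ofReal_sub] at h1
      have h2 : ‖((∫ x, f x ∂(posMeasure g C) - ∫ x, f x ∂(negMeasure g C) : ℝ) : ℂ)‖ ≤
          C⁻¹ * (holderDualNorm s g).toReal := by
        refine (congrArg _ h1).trans_le ?_
        rw [norm_mul, norm_inv, Complex.norm_real, Real.norm_of_nonneg hC.le]
        refine mul_le_mul_of_nonneg_left ?_ (by positivity)
        have h3 := enorm_integral_le_holderDualNorm g hF (by simp [h0])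
        rw [← toReal_enorm]
        exact ENNReal.toReal_mono hfin.ne h3
      rw [Complex.norm_real] at h2
      exact (le_abs_self _).trans h2
  · simp only [holderDualNorm, ENNReal.mul_iSup]
    refine iSup_le fun f => iSup₂_le fun hf _ => ?_
    have hfc := hf.continuous hs0
    rw [← hCe, ← enorm_mul, ← integral_posMeasure_sub_integral_negMeasure hg hgc hreal hC hfc]
    exact enorm_integral_sub_integral_le_wassersteinDist hf (hpos.integrable hK hfc)
      (hneg.integrable hK hfc)

/-! ### Orthogonality of the wavelet system -/

theorem IsHilbertBasisOf.mem {n : ℕ} {ι : Type*} {u : ι → Rn n → ℂ} {V : Submodule ℂ (L2 n)}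
    (h : IsHilbertBasisOf u V) {i : ι} (hi : MemLp (u i) 2 (volume : Measure (Rn n))) :
    hi.toLp (u i) ∈ V := by
  obtain ⟨_, _, rfl⟩ := h
  exact Submodule.le_topologicalClosure _ (Submodule.subset_span ⟨i, rfl⟩)

theorem inner_toLp_eq_integral {n : ℕ} {f g : Rn n → ℂ}
    (hf : MemLp f 2 (volume : Measure (Rn n))) (hg : MemLp g 2 (volume : Measure (Rn n))) :
    inner ℂ (hf.toLp f) (hg.toLp g) = ∫ x, g x * conj (f x) := by
  rw [L2.inner_def]
  refine integral_congr_ae ?_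
  filter_upwards [hf.coeFn_toLp, hg.coeFn_toLp] with x h1 h2
  rw [h1, h2]
  rfl

theorem IsHilbertBasisOf.integral_mul_conj_self {n : ℕ} {ι : Type*} {u : ι → Rn n → ℂ}
    {V : Submodule ℂ (L2 n)} (h : IsHilbertBasisOf u V) (i : ι) :
    ∫ x, u i x * conj (u i x) = 1 := by
  obtain ⟨hm, ho, _⟩ := h
  rw [← inner_toLp_eq_integral (hm i) (hm i), inner_self_eq_norm_sq_to_K, ho.1 i]
  simp

theorem IsHilbertBasisOf.integral_mul_conj_of_ne {n : ℕ} {ι : Type*} {u : ι → Rn n → ℂ}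
    {V : Submodule ℂ (L2 n)} (h : IsHilbertBasisOf u V) {i i' : ι} (hne : i ≠ i') :
    ∫ x, u i' x * conj (u i x) = 0 := by
  obtain ⟨hm, ho, _⟩ := h
  rw [← inner_toLp_eq_integral (hm i) (hm i')]
  exact ho.2 hne

/-- The coarser detail lies in `V (i + 1) ⊆ V j` when `i < j`, and the finer one is orthogonal to `V
j`. -/
theorem inner_eq_zero_of_mem_details {n : ℕ} {V : ℤ → Submodule ℂ (L2 n)} (hV : Monotone V)
    {i j : ℤ} (hij : i ≠ j) {f g : L2 n} (hf : f ∈ (V i)ᗮ ⊓ V (i + 1))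
    (hg : g ∈ (V j)ᗮ ⊓ V (j + 1)) : inner ℂ f g = 0 := by
  rcases lt_or_gt_of_ne hij with h | h
  · exact hg.1 f (hV (Int.add_one_le_iff.2 h) hf.2)
  · exact inner_eq_zero_symm.1 (hf.1 g (hV (Int.add_one_le_iff.2 h) hg.2))

namespace IsWaveletSystem

variable {n : ℕ} {α : Type*} {φ : Rn n → ℂ} {ψ : α → Rn n → ℂ}

theorem detailCoeff_self (h : IsWaveletSystem φ ψ) (ε : α) (j : ℤ) (k : Fin n → ℤ) :
    detailCoeff ψ (dilate (ψ ε) j k) ε j k = 1 := by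
  obtain ⟨V, _, _, hW⟩ := h
  exact (hW j).integral_mul_conj_self (ε, k)

theorem detailCoeff_of_ne (h : IsWaveletSystem φ ψ) {ε ε' : α} {j j' : ℤ} {k k' : Fin n → ℤ}
    (hne : (ε, j, k) ≠ (ε', j', k')) : detailCoeff ψ (dilate (ψ ε') j' k') ε j k = 0 := by
  obtain ⟨V, hV, _, hW⟩ := h
  by_cases hj : j = j'
  · subst hj
    refine (hW j).integral_mul_conj_of_ne (i := (ε, k)) (i' := (ε', k')) fun h => hne ?_
    simp_all
  · obtain ⟨hm, _⟩ := hW j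
    obtain ⟨hm', _⟩ := hW j'
    have := inner_eq_zero_of_mem_details hV.mono hj ((hW j).mem (hm (ε, k)))
      ((hW j').mem (hm' (ε', k')))
    rwa [inner_toLp_eq_integral] at this

/-- Without wavelets every detail space is zero, so all `V j` coincide with their intersection
`{0}`; but `V 0` contains a unit vector, the class of a translate of `φ`. -/
theorem nonempty_index (h : IsWaveletSystem φ ψ) : Nonempty α := by
  by_contra hα
  rw [not_nonempty_iff] at hα
  obtain ⟨V, hV, _, hW⟩ := h
  have hbot : ∀ j, (V j)ᗮ ⊓ V (j + 1) = ⊥ := fun j => by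
    obtain ⟨_, _, he⟩ := hW j
    rw [← he, range_eq_empty, Submodule.span_empty]
    exact IsClosed.submodule_topologicalClosure_eq (by simp)
  have hstep : ∀ j, V (j + 1) = V j := fun j => by
    refine le_antisymm (fun f hf => ?_) (hV.mono (by omega))
    have : CompleteSpace (V j) := (hV.isClosed j).completeSpace_coe
    have h1 : f - (V j).starProjection f ∈ (V j)ᗮ ⊓ V (j + 1) :=
      ⟨(V j).sub_starProjection_mem_orthogonal f,
        sub_mem hf (hV.mono (show j ≤ j + 1 by omega) ((V j).starProjection_apply_mem f))⟩
    rw [hbot, Submodule.mem_bot, sub_eq_zero] at h1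
    rw [h1]
    exact (V j).starProjection_apply_mem f
  have hall : ∀ j, V j = V 0 := fun j => by
    induction j using Int.induction_on with
    | zero => rfl
    | succ i ih => rw [hstep, ih]
    | pred i ih => rw [← ih, ← hstep (-i - 1), sub_add_cancel]
  have hzero : (V 0 : Set (L2 n)) = {0} := by
    rw [← hV.inter]
    simp only [hall, iInter_const]
  obtain ⟨hm, ho, _⟩ := hV.scaling_basis 0
  have h0 := (hV.scaling_basis 0).mem (hm 0)
  rw [← SetLike.mem_coe, hzero, mem_singleton_iff] at h0
  have h1 := ho.1 0
  simp only [h0, norm_zero] at h1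
  exact zero_ne_one h1

theorem integral_wavelet (h : IsWaveletSystem φ ψ) (ε : α) : ∫ x, ψ ε x = 0 := by
  obtain ⟨V, _, hψ, _⟩ := h
  exact (hψ ε).2

end IsWaveletSystem

/-! ### Dilates and their supports -/

theorem dilate_zero_zero {n : ℕ} (f : Rn n → ℂ) : dilate f 0 0 = f := by
  funext x
  have : latticeVec (0 : Fin n → ℤ) = 0 := by
    ext i; simp [latticeVec]
  simp [dilate, this]

theorem Continuous.dilate {n : ℕ} {f : Rn n → ℂ} (hf : Continuous f) (j : ℤ)
    (k : Fin n → ℤ) : Continuous (dilate f j k) := by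
  unfold _root_.dilate
  fun_prop

theorem dilate_im {n : ℕ} {f : Rn n → ℂ} (hf : ∀ x, (f x).im = 0) (j : ℤ)
    (k : Fin n → ℤ) (x : Rn n) : (dilate f j k x).im = 0 := by
  rw [dilate, Complex.im_ofReal_mul, hf, mul_zero]

theorem integral_dilate {n : ℕ} {f : Rn n → ℂ} (hf : ∫ x, f x = 0) (j : ℤ)
    (k : Fin n → ℤ) : ∫ x, dilate f j k x = 0 := by
  simp only [dilate]
  rw [integral_const_mul, integral_comp_smul_sub (zpow_pos two_pos j), hf, mul_zero, mul_zero]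

theorem norm_sub_latticeVec_floor_le {n : ℕ} (x : Rn n) :
    ‖x - latticeVec fun i => ⌊x i⌋‖ ≤ √n := by
  rw [EuclideanSpace.norm_eq]
  refine Real.sqrt_le_sqrt ?_
  calc ∑ i, ‖(x - latticeVec fun i => ⌊x i⌋) i‖ ^ 2 ≤ ∑ _ : Fin n, (1 : ℝ) := by
        refine Finset.sum_le_sum fun i _ => ?_
        have h : (x - latticeVec fun i => ⌊x i⌋) i = Int.fract (x i) := by
          simp [latticeVec, Int.self_sub_floor]
        rw [h, Real.norm_of_nonneg (Int.fract_nonneg _)]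
        exact pow_le_one₀ (Int.fract_nonneg _) (Int.fract_lt_one _).le
    _ = n := by simp

/-- Dilates of a compactly supported function fit into any set with interior points. -/
theorem exists_tsupport_dilate_subset {n : ℕ} {f : Rn n → ℂ} (hf : HasCompactSupport f)
    {K : Set (Rn n)} (hK : IsCompact K) (hKint : (interior K).Nonempty) (j₀ : ℤ) :
    ∃ (j : ℤ) (k : Fin n → ℤ), j₀ ≤ j ∧ tsupport (dilate f j k) ⊆ K := by
  obtain ⟨x₀, hx₀⟩ := hKint
  obtain ⟨r, hr, hball⟩ := Metric.isOpen_iff.1 isOpen_interior x₀ hx₀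
  obtain ⟨R, hR⟩ := hf.isCompact.isBounded.exists_norm_le
  -- At level `j` the support lies within `(R + √n) / 2^j` of `x₀`: `R` bounds the original support,
  -- and `√n` the error of rounding `2^j x₀` to the lattice.
  obtain ⟨N, hN⟩ := pow_unbounded_of_one_lt ((R + √n) / r) (one_lt_two (α := ℝ))
  refine ⟨max j₀ N, fun i => ⌊((2 : ℝ) ^ (max j₀ N) • x₀) i⌋, le_max_left _ _, ?_⟩
  set j : ℤ := max j₀ N
  have hj : (0 : ℝ) < 2 ^ j := zpow_pos two_pos j
  refine closure_minimal (fun x hx => interior_subset (hball ?_)) hK.isClosed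
  rw [Metric.mem_ball, dist_eq_norm]
  have h1 := hR _ (subset_tsupport f (right_ne_zero_of_mul hx))
  have h2 := norm_sub_latticeVec_floor_le ((2 : ℝ) ^ j • x₀)
  have h3 : (2 : ℝ) ^ j * ‖x - x₀‖ ≤ R + √n := by
    rw [← Real.norm_of_nonneg hj.le, ← norm_smul, smul_sub,
      ← sub_sub_sub_cancel_right _ _ (latticeVec fun i => ⌊((2 : ℝ) ^ j • x₀) i⌋)]
    exact (norm_sub_le _ _).trans (add_le_add h1 h2)
  have h4 : (R + √n) / r < 2 ^ j := hN.trans_le <| by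
    rw [← zpow_natCast]
    exact zpow_le_zpow_right₀ one_le_two (le_max_right _ _)
  rw [div_lt_iff₀ hr] at h4
  exact lt_of_mul_lt_mul_left (h3.trans_lt h4) hj.le

/-! ### The wavelet distance -/

theorem waveletDist_antitone {n : ℕ} {α : Type*} (ψ : α → Rn n → ℂ) {i j : ℤ} (hij : i ≤ j)
    (s : ℝ≥0) (μ ν : Measure (Rn n)) : waveletDist ψ j s μ ν ≤ waveletDist ψ i s μ ν := by
  let e : α × {l : ℤ // j ≤ l} × (Fin n → ℤ) → α × {l : ℤ // i ≤ l} × (Fin n → ℤ) :=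
    fun p => (p.1, ⟨p.2.1.1, hij.trans p.2.1.2⟩, p.2.2)
  have he : Function.Injective e := by
    rintro ⟨a, ⟨l, hl⟩, k⟩ ⟨a', ⟨l', hl'⟩, k'⟩ h
    simpa [e] using h
  exact ENNReal.tsum_comp_le_tsum_of_injective he fun i : α × {l : ℤ // i ≤ l} × (Fin n → ℤ) =>
    ENNReal.ofReal ((2 : ℝ) ^ (-((i.2.1.1 : ℤ) : ℝ) * ((s : ℝ) + (n : ℝ) / 2))) *
      ‖detailCoeff ψ (densityDiff μ ν) i.1 i.2.1.1 i.2.2‖ₑ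

/-- The wavelet distance of the normalized parts of one wavelet has a single nonzero term. -/
theorem IsWaveletSystem.waveletDist_posMeasure_negMeasure {n : ℕ} {α : Type*} {φ : Rn n → ℂ}
    {ψ : α → Rn n → ℂ} (h : IsWaveletSystem φ ψ) {ε : α} (hψ : Continuous (ψ ε))
    (hreal : ∀ x, (ψ ε x).im = 0) (s : ℝ≥0) {i j : ℤ} (hij : i ≤ j) (k : Fin n → ℤ) {C : ℝ}
    (hC : 0 < C) :
    waveletDist ψ i s (posMeasure (dilate (ψ ε) j k) C) (negMeasure (dilate (ψ ε) j k) C) =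
      ENNReal.ofReal ((2 : ℝ) ^ (-(j : ℝ) * ((s : ℝ) + (n : ℝ) / 2))) * ENNReal.ofReal C⁻¹ := by
  have hd := densityDiff_posMeasure_negMeasure (hψ.dilate j k) (dilate_im hreal j k) hC
  have hcoeff : ∀ ε' j' k', detailCoeff ψ (densityDiff (posMeasure (dilate (ψ ε) j k) C)
      (negMeasure (dilate (ψ ε) j k) C)) ε' j' k' =
        (C : ℂ)⁻¹ * detailCoeff ψ (dilate (ψ ε) j k) ε' j' k' := fun ε' j' k' => by
    rw [detailCoeff, detailCoeff, ← integral_const_mul]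
    refine integral_congr_ae ?_
    filter_upwards [hd] with x hx
    rw [hx, mul_assoc]
  rw [waveletDist, tsum_eq_single (ε, ⟨j, hij⟩, k)]
  · rw [hcoeff, h.detailCoeff_self, mul_one, ← ofReal_norm, norm_inv, Complex.norm_real,
      Real.norm_of_nonneg hC.le]
  · rintro ⟨ε', ⟨j', hj'⟩, k'⟩ hne
    rw [hcoeff, h.detailCoeff_of_ne, mul_zero, enorm_zero, mul_zero]
    intro he
    simp only [Prod.mk.injEq] at he
    obtain ⟨rfl, rfl, rfl⟩ := he
    exact hne rfl

/-! ### Attainment and optimality of the constant -/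

theorem integral_re_eq_zero {n : ℕ} {g : Rn n → ℂ} (hgi : Integrable g) (hmean : ∫ x, g x = 0) :
    ∫ x, (g x).re = 0 := by
  have := integral_re hgi
  simp only [RCLike.re_to_complex] at this
  rw [this, hmean, Complex.zero_re]

theorem integral_posPart_re_eq_integral_negPart_re {n : ℕ} {g : Rn n → ℂ} (hg : Continuous g)
    (hgc : HasCompactSupport g) (hmean : ∫ x, g x = 0) :
    ∫ x, (g x).re⁺ = ∫ x, (g x).re⁻ := by
  rw [← sub_eq_zero, ← integral_sub
    ((continuous_posPart_re hg).integrable_of_hasCompactSupport (hasCompactSupport_posPart_re hgc))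
    ((continuous_negPart_re hg).integrable_of_hasCompactSupport (hasCompactSupport_negPart_re hgc))]
  simp only [posPart_sub_negPart]
  exact integral_re_eq_zero (hg.integrable_of_hasCompactSupport hgc) hmean

/-- If the positive part had integral zero, mean zero would kill the negative part too, and `g`
would vanish almost everywhere. -/
theorem integral_posPart_re_pos {n : ℕ} {g : Rn n → ℂ} (hg : Continuous g)
    (hgc : HasCompactSupport g) (hreal : ∀ x, (g x).im = 0) (hmean : ∫ x, g x = 0)
    (hne : ∫ x, g x * conj (g x) ≠ 0) : 0 < ∫ x, (g x).re⁺ := by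
  have hip := (continuous_posPart_re hg).integrable_of_hasCompactSupport (μ := volume)
    (hasCompactSupport_posPart_re hgc)
  have hin := (continuous_negPart_re hg).integrable_of_hasCompactSupport (μ := volume)
    (hasCompactSupport_negPart_re hgc)
  refine lt_of_le_of_ne (integral_nonneg fun x => posPart_nonneg _) fun h0 => hne ?_
  have h1 := h0.symm
  have h2 := h1
  rw [integral_posPart_re_eq_integral_negPart_re hg hgc hmean] at h2
  rw [integral_eq_zero_iff_of_nonneg (fun x => posPart_nonneg _) hip] at h1
  rw [integral_eq_zero_iff_of_nonneg (fun x => negPart_nonneg _) hin] at h2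
  refine integral_eq_zero_of_ae ?_
  filter_upwards [h1, h2] with x hx1 hx2
  have hx : (g x).re = 0 := by
    rw [← posPart_sub_negPart (g x).re]
    simp_all
  have : g x = 0 := Complex.ext hx (hreal x)
  simp [this]

theorem lowerConst_pos_lt_top {n : ℕ} {α : Type*} [Finite α] {s : ℝ≥0} {ψ : α → Rn n → ℂ} {ε : α}
    (hpos : 0 < holderDualNorm s (ψ ε)) (hfin : ∀ ε, holderDualNorm s (ψ ε) < ∞) :
    0 < lowerConst ψ s ∧ lowerConst ψ s < ∞ := by
  have : Nonempty α := ⟨ε⟩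
  obtain ⟨ε', hε'⟩ := exists_eq_ciSup_of_finite (f := fun ε => holderDualNorm s (ψ ε))
  rw [lowerConst, ENNReal.inv_pos, ENNReal.inv_lt_top]
  exact ⟨hε' ▸ (hfin ε').ne, hpos.trans_le (le_iSup (fun ε => holderDualNorm s (ψ ε)) ε)⟩

theorem IsWaveletSystem.holderDualNorm_wavelet_pos {n : ℕ} {α : Type*} {s : ℝ≥0} (hs1 : s ≤ 1)
    {φ : Rn n → ℂ} {ψ : α → Rn n → ℂ} (h : IsWaveletSystem φ ψ) {ε : α}
    (hψ : ContDiff ℝ 1 (ψ ε)) (hψc : HasCompactSupport (ψ ε)) (hreal : ∀ x, (ψ ε x).im = 0) :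
    0 < holderDualNorm s (ψ ε) := by
  obtain ⟨L, hL⟩ := hψ.lipschitzWith_of_hasCompactSupport hψc one_ne_zero
  refine holderDualNorm_pos hs1 hL hψc (h.integral_wavelet ε) ?_
  have h1 := h.detailCoeff_self ε 0 0
  rw [detailCoeff, dilate_zero_zero] at h1
  -- Reality turns the normalization `∫ ψ conj ψ = 1` into `∫ ψ² = 1`, the nondegeneracy needed
  -- without conjugation.
  simp only [Complex.conj_eq_iff_im.2 (hreal _)] at h1
  exact h1 ▸ one_ne_zero

/-- A wavelet maximizing the dual Hölder norm attains the lower bound at every scale at which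
its support fits into `K`. -/
theorem IsWaveletSystem.exists_wavelet_attaining_lowerConst {n : ℕ} {α : Type*} [Finite α]
    {s : ℝ≥0} (hs0 : 0 < s) (hs1 : s ≤ 1) {φ : Rn n → ℂ} {ψ : α → Rn n → ℂ}
    (hsys : IsWaveletSystem φ ψ) (hψ : ∀ ε, ContDiff ℝ 1 (ψ ε))
    (hψc : ∀ ε, HasCompactSupport (ψ ε)) (hreal : ∀ ε x, (ψ ε x).im = 0)
    {K : Set (Rn n)} (hK : IsCompact K) (hKint : (interior K).Nonempty) (j₀ : ℤ) :
    ∃ (ε' : α) (j' : ℤ) (k' : Fin n → ℤ), j₀ ≤ j' ∧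
      tsupport (dilate (ψ ε') j' k') ⊆ K ∧
      ∃ C : ℝ, 0 < C ∧
        ∫ x, (dilate (ψ ε') j' k' x).re⁺ = C ∧
        ∫ x, (dilate (ψ ε') j' k' x).re⁻ = C ∧
        IsAb2On K (posMeasure (dilate (ψ ε') j' k') C) ∧
        IsAb2On K (negMeasure (dilate (ψ ε') j' k') C) ∧
        0 < wassersteinDist s (posMeasure (dilate (ψ ε') j' k') C)
          (negMeasure (dilate (ψ ε') j' k') C) ∧
        wassersteinDist s (posMeasure (dilate (ψ ε') j' k') C)
          (negMeasure (dilate (ψ ε') j' k') C) < ∞ ∧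
        ∀ j : ℤ, j ≤ j' →
          lowerConst ψ s * wassersteinDist s (posMeasure (dilate (ψ ε') j' k') C)
              (negMeasure (dilate (ψ ε') j' k') C) =
            waveletDist ψ j s (posMeasure (dilate (ψ ε') j' k') C)
              (negMeasure (dilate (ψ ε') j' k') C) := by
  have := hsys.nonempty_index
  -- Only a wavelet of maximal dual norm has quotient exactly `lowerConst`; finiteness of `α`
  -- provides one.
  obtain ⟨ε, hε⟩ := exists_eq_ciSup_of_finite (f := fun ε => holderDualNorm s (ψ ε))
  obtain ⟨j', k', hj, hsupp⟩ := exists_tsupport_dilate_subset (hψc ε) hK hKint j₀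
  have hψcont := (hψ ε).continuous
  have hg : Continuous (dilate (ψ ε) j' k') := hψcont.dilate j' k'
  have hgc : HasCompactSupport (dilate (ψ ε) j' k') :=
    hK.of_isClosed_subset (isClosed_tsupport _) hsupp
  have hgreal := dilate_im (hreal ε) j' k'
  have hmean := integral_dilate (hsys.integral_wavelet ε) j' k'
  have hN0 := hsys.holderDualNorm_wavelet_pos hs1 (hψ ε) (hψc ε) (hreal ε)
  have hNfin := holderDualNorm_lt_top s hψcont (hψc ε)
  have hC : 0 < ∫ x, (dilate (ψ ε) j' k' x).re⁺ := by
    refine integral_posPart_re_pos hg hgc hgreal hmean ?_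
    have h1 := hsys.detailCoeff_self ε j' k'
    rw [detailCoeff] at h1
    exact h1 ▸ one_ne_zero
  have hneg := (integral_posPart_re_eq_integral_negPart_re hg hgc hmean).symm
  refine ⟨ε, j', k', hj, hsupp, _, hC, rfl, hneg, ?_⟩
  set C := ∫ x, (dilate (ψ ε) j' k' x).re⁺
  have hp := isAb2On_posMeasure hK hg hsupp hC rfl
  have hn := isAb2On_negMeasure hK hg hsupp hC hneg
  have hW := wassersteinDist_posMeasure_negMeasure hs0 hs1 hK hg hgc hgreal hC hp hn
  rw [holderDualNorm_dilate hs0 hψcont (hψc ε) (hsys.integral_wavelet ε)] at hW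
  have hr : (0 : ℝ) < 2 ^ (-(j' : ℝ) * ((s : ℝ) + (n : ℝ) / 2)) := Real.rpow_pos_of_pos two_pos _
  refine ⟨hp, hn, ?_, ?_, fun j hjj => ?_⟩
  · rw [hW]
    exact ENNReal.mul_pos (ENNReal.ofReal_pos.2 (inv_pos.2 hC)).ne'
      (ENNReal.mul_pos (ENNReal.ofReal_pos.2 hr).ne' hN0.ne').ne'
  · rw [hW]
    exact ENNReal.mul_lt_top ENNReal.ofReal_lt_top (ENNReal.mul_lt_top ENNReal.ofReal_lt_top hNfin)
  · rw [hsys.waveletDist_posMeasure_negMeasure hψcont (hreal ε) s hjj k' hC, hW, lowerConst, ← hε]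
    calc _ = (holderDualNorm s (ψ ε))⁻¹ * holderDualNorm s (ψ ε) *
          (ENNReal.ofReal ((2 : ℝ) ^ (-(j' : ℝ) * ((s : ℝ) + (n : ℝ) / 2))) *
            ENNReal.ofReal C⁻¹) := by ring
      _ = _ := by rw [ENNReal.inv_mul_cancel hN0.ne' hNfin.ne, one_mul]

theorem mainTheorem4 {n : ℕ} {α : Type*} [Finite α]
    (s : ℝ≥0) (hs0 : 0 < s) (hs1 : s < 1)
    (φ : Rn n → ℂ) (ψ : α → Rn n → ℂ)
    (hsys : IsWaveletSystem φ ψ)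
    (hφ : ContDiff ℝ 1 φ) (hφc : HasCompactSupport φ)
    (hψ : ∀ ε, ContDiff ℝ 1 (ψ ε)) (hψc : ∀ ε, HasCompactSupport (ψ ε))
    (hψ_real : ∀ ε x, (ψ ε x).im = 0)
    (K : Set (Rn n)) (hK : IsCompact K) (hKint : (interior K).Nonempty) :
    -- the constant is a positive real number
    (0 < lowerConst ψ s ∧ lowerConst ψ s < ∞) ∧
    -- equality is attained by the normalized parts of a single wavelet supported in `K`
    (∀ j₀ : ℤ, ∃ (ε' : α) (j' : ℤ) (k' : Fin n → ℤ), j₀ ≤ j' ∧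
      tsupport (dilate (ψ ε') j' k') ⊆ K ∧
      ∃ C : ℝ, 0 < C ∧
        ∫ x, (dilate (ψ ε') j' k' x).re⁺ = C ∧
        ∫ x, (dilate (ψ ε') j' k' x).re⁻ = C ∧
        IsAb2On K (posMeasure (dilate (ψ ε') j' k') C) ∧
        IsAb2On K (negMeasure (dilate (ψ ε') j' k') C) ∧
        0 < wassersteinDist s (posMeasure (dilate (ψ ε') j' k') C)
          (negMeasure (dilate (ψ ε') j' k') C) ∧
        wassersteinDist s (posMeasure (dilate (ψ ε') j' k') C)
          (negMeasure (dilate (ψ ε') j' k') C) < ∞ ∧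
        ∀ j : ℤ, j ≤ j' →
          lowerConst ψ s * wassersteinDist s (posMeasure (dilate (ψ ε') j' k') C)
              (negMeasure (dilate (ψ ε') j' k') C) =
            waveletDist ψ j s (posMeasure (dilate (ψ ε') j' k') C)
              (negMeasure (dilate (ψ ε') j' k') C)) ∧
    -- no larger constant is admissible in the lower bound, whatever the error terms
    (∀ c : ℝ≥0,
      (∀ η : ℝ≥0, 0 < η → ∃ j₀ : ℤ, ∀ μ ν : Measure (Rn n), IsAb2On K μ → IsAb2On K ν →
        (c : ℝ≥0∞) * wassersteinDist s μ ν ≤ waveletDist ψ j₀ s μ ν + (η : ℝ≥0∞)) →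
      (c : ℝ≥0∞) ≤ lowerConst ψ s) := by
  have hattain := hsys.exists_wavelet_attaining_lowerConst hs0 hs1.le hψ hψc hψ_real hK hKint
  refine ⟨?_, hattain, fun c hc => ?_⟩
  · obtain ⟨ε⟩ := hsys.nonempty_index
    exact lowerConst_pos_lt_top
      (hsys.holderDualNorm_wavelet_pos hs1.le (hψ ε) (hψc ε) (hψ_real ε))
      fun ε => holderDualNorm_lt_top s (hψ ε).continuous (hψc ε)
  -- The starting level `0` is arbitrary; what matters is that the pair is fixed before `η`.
  · obtain ⟨ε, j', k', _, _, C, _, _, _, hp, hn, hW0, hWfin, heq⟩ := hattain 0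
    refine (ENNReal.mul_le_mul_iff_left hW0.ne' hWfin.ne).1 ?_
    refine ENNReal.le_of_forall_pos_le_add fun η hη _ => ?_
    obtain ⟨j₀, hj₀⟩ := hc η hη
    refine (hj₀ _ _ hp hn).trans ?_
    gcongr
    -- Equality is known only at levels up to `j'`, while `j₀` depends on `η` and may exceed `j'`.
    rw [heq (min j₀ j') (min_le_right _ _)]
    exact waveletDist_antitone ψ (min_le_left _ _) s _ _
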